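/- **Language.** The intuitionistic predicate language has countably many individual variables, countably many predicate letters of every arity $n\ge 0$, the constant $\bot$, the connectives $\wedge,\vee,\to$ and the quantifiers $\forall,\exists$; there is no equality. **Semantics.** Let $F=\langle W,R\rangle$ be a non-empty partially ordered set. An augmented frame over $F$ (with expanding domains) is given by non-empty sets $D_w$ ($w\in W$) of individuals with $D_u\subseteq D_w$ whenever $uRw$; it has constant domains if moreover $D_u=D_w$ whenever $uRw$. A model over it assigns to each world $w$ and each $n$-ary predicate letter $P$ a relation $I(w,P)\subseteq D_w^n$ such that $uRw$ implies $I(u,P)\subseteq I(w,P)$. Truth of a formula at a world $w$ under an assignment $g$ of individuals to the variables is defined as usual: atomic formulas are evaluated by $I(w,\cdot)$; $\bot$ is never true; $\wedge$ and $\vee$ are evaluated at $w$; $\varphi\to\psi$ is true at $w$ under $g$ iff, for every $v$ with $wRv$, truth of $\varphi$ at $v$ under $g$ implies truth of $\psi$ at $v$ under $g$; $\forall x\,\varphi$ is true at $w$ under $g$ iff $\varphi$ is true at $v$ under $g[x\mapsto d]$ for all $v$ with $wRv$ and all $d\in D_v$; $\exists x\,\varphi$ is true at $w$ under $g$ iff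 $\varphi$ is true at $w$ under $g[x\mapsto d]$ for some $d\in D_w$. A formula is valid on an augmented frame if, in every model over it, it is true at every world $w$ under every assignment that sends its free variables into $D_w$. Let $\mathrm{QSIL}_e F$ be the set of formulas valid on all augmented frames over $F$ (with expanding domains), and $\mathrm{QSIL}_c F$ the set of formulas valid on all augmented frames over $F$ with constant domains. **Hardness.** A set $L$ of formulas is called $\Sigma^0_1$-hard in the language with two individual variables, a single binary predicate letter and infinitely many unary predicate letters if every recursively enumerable set $A\subseteq\mathbb N$ is many-one reducible to $L$ by a computable map $f$ from $\mathbb N$ to formulas (so $n\in A\iff f(n)\in L$), all of whose values contain no individual variables (free or bound) other than two fixed ones, and no predicate letters other than one fixed binary letter and unary letters. **Corollary.** Let $F$ be one of the frames $\langle\mathbb Z,\leqslant\rangle$, $\langle\mathbb R,\leqslant\rangle$ or $\langle\alpha,\subseteq\rangle$, where $\alpha$ is an infinite ordinal. Then both $\mathrm{QSIL}_e F$ and $\mathrm{QSIL}_c F$ are $\Sigma^0_1$-hard in the language with two individual variables, a single binary predicate letter, and infinitely many unary predicate letters. -/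

import Mathlib

universe u v

namespace SuperInt

/-- Formulas of the intuitionistic predicate language. The individual variables are indexed by `ℕ`,
and for every arity `n` there are countably many `n`-ary predicate letters, indexed by `ℕ`:
`atom n k x` is `P(x 0, …, x (n-1))` with `P` the `k`-th `n`-ary letter. -/
inductive Formula : Type
  | bot : Formula
  | atom (n k : ℕ) (x : Fin n → ℕ) : Formula
  | and (φ ψ : Formula) : Formula
  | or (φ ψ : Formula) : Formula
  | imp (φ ψ : Formula) : Formula
  | all (x : ℕ) (φ : Formula) : Formula
  | ex (x : ℕ) (φ : Formula) : Formula

namespace Formula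

/-- The set of variables with a free occurrence in a formula. -/
def freeVars : Formula → Set ℕ
  | bot => ∅
  | atom _ _ x => Set.range x
  | and φ ψ => freeVars φ ∪ freeVars ψ
  | or φ ψ => freeVars φ ∪ freeVars ψ
  | imp φ ψ => freeVars φ ∪ freeVars ψ
  | all x φ => freeVars φ \ {x}
  | ex x φ => freeVars φ \ {x}

/-! ### Gödel numbering -/

/-- The Gödel number of a formula. -/
def toNat : Formula → ℕ
  | bot => 0
  | atom _ k x => 6 * Encodable.encode (k, List.ofFn x) + 1
  | and φ ψ => 6 * Nat.pair (toNat φ) (toNat ψ) + 1 + 1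
  | or φ ψ => 6 * Nat.pair (toNat φ) (toNat ψ) + 2 + 1
  | imp φ ψ => 6 * Nat.pair (toNat φ) (toNat ψ) + 3 + 1
  | all x φ => 6 * Nat.pair x (toNat φ) + 4 + 1
  | ex x φ => 6 * Nat.pair x (toNat φ) + 5 + 1

/-- The formula with a given Gödel number. -/
def ofNat : ℕ → Formula
  | 0 => bot
  | n + 1 =>
    let m := n / 6
    have hm : m < n + 1 := Nat.lt_succ_of_le (Nat.div_le_self n 6)
    have _h1 : m.unpair.1 < n + 1 := lt_of_le_of_lt m.unpair_left_le hm
    have _h2 : m.unpair.2 < n + 1 := lt_of_le_of_lt m.unpair_right_le hm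
    match n % 6 with
    | 0 =>
      let p := Denumerable.ofNat (ℕ × List ℕ) m
      atom p.2.length p.1 p.2.get
    | 1 => and (ofNat m.unpair.1) (ofNat m.unpair.2)
    | 2 => or (ofNat m.unpair.1) (ofNat m.unpair.2)
    | 3 => imp (ofNat m.unpair.1) (ofNat m.unpair.2)
    | 4 => all m.unpair.1 (ofNat m.unpair.2)
    | _ => ex m.unpair.1 (ofNat m.unpair.2)
termination_by n => n
decreasing_by all_goals first | exact _h1 | exact _h2

theorem atom_ofFn (n k : ℕ) (x : Fin n → ℕ) (l : List ℕ) (h : l = List.ofFn x) :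
    atom l.length k l.get = atom n k x := by
  subst h
  have key : ∀ (m : ℕ) (hm : m = n) (y : Fin m → ℕ), (∀ i, y i = x (Fin.cast hm i)) →
      atom m k y = atom n k x := by
    intro m hm y hy
    subst hm
    congr 1
    funext i
    simpa using hy i
  refine key _ (by simp) _ ?_
  intro i
  simp
  rfl

theorem ofNat_toNat (φ : Formula) : ofNat (toNat φ) = φ := by
  induction φ with
  | bot => simp [toNat, ofNat]
  | atom n k x =>
    rw [toNat, ofNat]
    have h1 : 6 * Encodable.encode (k, List.ofFn x) / 6
        = Encodable.encode (k, List.ofFn x) := by omega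
    have h2 : 6 * Encodable.encode (k, List.ofFn x) % 6 = 0 := by omega
    have h3 : Denumerable.ofNat (ℕ × List ℕ) (6 * Encodable.encode (k, List.ofFn x) / 6)
        = (k, List.ofFn x) := by rw [h1, Denumerable.ofNat_encode]
    simp only [h2]
    generalize Denumerable.ofNat (ℕ × List ℕ) (6 * Encodable.encode (k, List.ofFn x) / 6) = p at h3
    subst h3
    exact atom_ofFn n k x _ rfl
  | and φ ψ h1 h2 =>
    have e1 : (6 * Nat.pair (toNat φ) (toNat ψ) + 1) / 6 = Nat.pair (toNat φ) (toNat ψ) := by omega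
    have e2 : (6 * Nat.pair (toNat φ) (toNat ψ) + 1) % 6 = 1 := by omega
    rw [toNat, ofNat]; simp only [e1, e2, Nat.unpair_pair, h1, h2]
  | or φ ψ h1 h2 =>
    have e1 : (6 * Nat.pair (toNat φ) (toNat ψ) + 2) / 6 = Nat.pair (toNat φ) (toNat ψ) := by omega
    have e2 : (6 * Nat.pair (toNat φ) (toNat ψ) + 2) % 6 = 2 := by omega
    rw [toNat, ofNat]; simp only [e1, e2, Nat.unpair_pair, h1, h2]
  | imp φ ψ h1 h2 =>
    have e1 : (6 * Nat.pair (toNat φ) (toNat ψ) + 3) / 6 = Nat.pair (toNat φ) (toNat ψ) := by omega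
    have e2 : (6 * Nat.pair (toNat φ) (toNat ψ) + 3) % 6 = 3 := by omega
    rw [toNat, ofNat]; simp only [e1, e2, Nat.unpair_pair, h1, h2]
  | all x φ h =>
    have e1 : (6 * Nat.pair x (toNat φ) + 4) / 6 = Nat.pair x (toNat φ) := by omega
    have e2 : (6 * Nat.pair x (toNat φ) + 4) % 6 = 4 := by omega
    rw [toNat, ofNat]; simp only [e1, e2, Nat.unpair_pair, h]
  | ex x φ h =>
    have e1 : (6 * Nat.pair x (toNat φ) + 5) / 6 = Nat.pair x (toNat φ) := by omega
    have e2 : (6 * Nat.pair x (toNat φ) + 5) % 6 = 5 := by omega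
    rw [toNat, ofNat]; simp only [e1, e2, Nat.unpair_pair, h]

theorem toNat_ofNat (n : ℕ) : toNat (ofNat n) = n := by
  induction n using Nat.strong_induction_on with
  | _ n ih =>
    cases n with
    | zero => simp [toNat, ofNat]
    | succ n =>
      have hm : n / 6 < n + 1 := Nat.lt_succ_of_le (Nat.div_le_self n 6)
      have i1 := ih _ (lt_of_le_of_lt (n / 6).unpair_left_le hm)
      have i2 := ih _ (lt_of_le_of_lt (n / 6).unpair_right_le hm)
      have hp := Nat.pair_unpair (n / 6)
      have hr : n % 6 < 6 := Nat.mod_lt _ (by norm_num)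
      have hd := Nat.div_add_mod n 6
      rw [ofNat]
      generalize hq : n % 6 = r at *
      interval_cases r
      · have he : Encodable.encode (Denumerable.ofNat (ℕ × List ℕ) (n / 6)) = n / 6 :=
          Denumerable.encode_ofNat _
        simp only [toNat, List.ofFn_get, Prod.mk.eta]
        rw [he]; omega
      all_goals (simp only [toNat, i1, i2, hp]; omega)

/-- Formulas are in bijection with their Gödel numbers; this fixes what a computable function with
values in formulas is. -/
instance : Denumerable Formula :=
  Denumerable.mk' ⟨toNat, ofNat, ofNat_toNat, toNat_ofNat⟩

/-- The formulas in two fixed individual variables (the variables `0` and `1`, free or bound), one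
fixed binary predicate letter and unary predicate letters (all the countably many of them); no
other predicate letters occur. -/
def InFragment : Formula → Prop
  | bot => True
  | atom n k x => (n = 1 ∨ (n = 2 ∧ k = 0)) ∧ ∀ i, x i < 2
  | and φ ψ => InFragment φ ∧ InFragment ψ
  | or φ ψ => InFragment φ ∧ InFragment ψ
  | imp φ ψ => InFragment φ ∧ InFragment ψ
  | all x φ => x < 2 ∧ InFragment φ
  | ex x φ => x < 2 ∧ InFragment φ

end Formula

/-- An intuitionistic augmented frame (with expanding domains) based on the Kripke frame `⟨W, ≤⟩`.
-/
structure AugFrame (W : Type u) [PartialOrder W] where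
  /-- the set of individuals -/
  Ind : Type v
  /-- the domain of a world -/
  D : W → Set Ind
  nonempty : ∀ w, (D w).Nonempty
  expanding : ∀ u w, u ≤ w → D u ⊆ D w

namespace AugFrame

/-- The (locally) constant domain condition. -/
def IsConstant {W : Type u} [PartialOrder W] (A : AugFrame W) : Prop :=
  ∀ u w, u ≤ w → A.D u = A.D w

/-- An interpretation of predicate letters on an augmented frame: `I w n k` is the `n`-ary relation
on the domain of `w` that interprets the `k`-th `n`-ary letter at `w`. -/
structure Interp {W : Type u} [PartialOrder W] (A : AugFrame W) where
  I : W → (n k : ℕ) → Set (Fin n → A.Ind)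
  on_domain : ∀ w n k, ∀ a ∈ I w n k, ∀ i, a i ∈ A.D w
  heredity : ∀ u w, u ≤ w → ∀ n k, I u n k ⊆ I w n k

/-- Truth of a formula at a world of the model `⟨A, M⟩` under an assignment. -/
def Interp.Forces {W : Type u} [PartialOrder W] {A : AugFrame W} (M : A.Interp) :
    W → (ℕ → A.Ind) → Formula → Prop
  | _, _, .bot => False
  | w, g, .atom n k x => (fun i => g (x i)) ∈ M.I w n k
  | w, g, .and φ ψ => M.Forces w g φ ∧ M.Forces w g ψ
  | w, g, .or φ ψ => M.Forces w g φ ∨ M.Forces w g ψ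
  | w, g, .imp φ ψ => ∀ v, w ≤ v → M.Forces v g φ → M.Forces v g ψ
  | w, g, .all x φ => ∀ v, w ≤ v → ∀ d ∈ A.D v, M.Forces v (Function.update g x d) φ
  | w, g, .ex x φ => ∃ d ∈ A.D w, M.Forces w (Function.update g x d) φ

/-- A formula is valid on an augmented frame if, in every model based on it, it is true at every
world `w` under every assignment that maps its free variables into the domain of `w`. -/
def Valid {W : Type u} [PartialOrder W] (A : AugFrame W) (φ : Formula) : Prop :=
  ∀ (M : A.Interp) (w : W) (g : ℕ → A.Ind), (∀ x ∈ φ.freeVars, g x ∈ A.D w) → M.Forces w g φ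

end AugFrame

/-- The logic of a class of augmented frames based on `⟨W, ≤⟩`. -/
def QSIL {W : Type u} [PartialOrder W] (C : Set (AugFrame.{u, v} W)) : Set Formula :=
  {φ | ∀ A ∈ C, A.Valid φ}

/-- The logic of the Kripke frame `⟨W, ≤⟩` with expanding domains. The sets of individuals range
over the universe `Type v`. -/
def QSILe (W : Type u) [PartialOrder W] : Set Formula :=
  QSIL (Set.univ : Set (AugFrame.{u, v} W))

/-- The logic of the Kripke frame `⟨W, ≤⟩` with constant domains. The sets of individuals range
over the universe `Type v`. -/
def QSILc (W : Type u) [PartialOrder W] : Set Formula :=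
  QSIL {A : AugFrame.{u, v} W | A.IsConstant}

/-- `L` is `Σ⁰₁`-hard in the language given by the set `Frag` of formulas: every recursively
enumerable set of natural numbers is many-one reducible to `L` by a computable function all of
whose values are formulas from `Frag`. -/
def SigmaOneHardIn (Frag : Formula → Prop) (L : Set Formula) : Prop :=
  ∀ p : ℕ → Prop, REPred p →
    ∃ f : ℕ → Formula, Computable f ∧ (∀ n, Frag (f n)) ∧ ∀ n, p n ↔ f n ∈ L

end SuperInt

/-!
The same reduction works for all the frames, because all of them contain a strictly increasing
sequence of worlds `s 0 < s 1 < …`, and it serves expanding and constant domains alike. It uses no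
binary letter at all.

In a model, the truth value of a unary letter `P` on an individual `d`, as seen from a world `w`, is
the set of the worlds above `w` at which `P` holds of `d`. These truth values serve as numbers: an
individual codes a tuple, whose `j`-th coordinate is the truth value of the letter `coord j`, while
the truth value of `next j` is the successor of that coordinate. Zero is the value "true at `w`".
Equality of numbers is the formula `P(x) ↔ Q(y)`, which needs two variables only, and a sentence
`fals` that is not true at `w` allows equality to be negated. A few axioms (`Formula.tupleAx`)
ensure that successors are well defined and that every tuple of numbers is coded by an individual of
`w` (`exists_numerals`).

Further unary letters name graphs of primitive recursive functions. By induction on the definition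
of such a function, its graph is described by Horn clauses of the form `∀ x (φ → x ∈ e)`; since
individuals are tuples of any length, `φ` can be written with the two variables `x` and `y` used
alternately (`exists_axiomatizes`). The Horn clauses only have to force positive facts, and so they
make every true equation `f(a) = b` true in every model, whatever its domains are.

A recursively enumerable set has the form `{n | ∃ k, f(n, k) = 0}` with `f` primitive recursive.
The formula `Formula.reduction` states that the axioms together with
`∀ x (x = (n, k, 0) for some k and x lies on the graph of f → fals)` imply `fals`. It is valid for
every member `n` of the set (`valid_reduction`). For other `n` it fails at `s 0` in the model
`tupleModel` with constant domain `ℕ → ℕ`, in which the number `m` is the set of worlds above `s m`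
(`not_valid_reduction`): from `s 1` on, `fals` and all graph letters are true, so
that the clauses hold trivially there, and at the worlds from `s 0` on but not above `s 1` equality
and the graph letters can be evaluated classically.
-/

namespace SuperInt

open Formula

/-! ### Two-variable formulas with unary letters -/

namespace Formula

/-- The atomic formula `P_k(x)` with the `k`-th unary letter. -/
def lit (k x : ℕ) : Formula := atom 1 k fun _ => x

/-- The conjunction of a list of formulas; the empty conjunction is `⊥ → ⊥`. -/
def conj (l : List Formula) : Formula := l.foldr and (imp bot bot)

/-- The conjunction of `φ 0, …, φ (n - 1)`. -/
def conjTo (n : ℕ) (φ : ℕ → Formula) : Formula := conj ((List.range n).map φ)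

/-- `P_k(x) ↔ P_l(y)`. -/
def eqv (k x l y : ℕ) : Formula := and (imp (lit k x) (lit l y)) (imp (lit l y) (lit k x))

/-- The unary letter whose truth value on an individual is its `j`-th coordinate. -/
def coord (j : ℕ) : ℕ := 4 * j + 1

/-- The unary letter whose truth value on an individual is the successor of its `j`-th
coordinate. -/
def next (j : ℕ) : ℕ := 4 * j + 2

/-- The unary letter for the set of tuples with number `e`, see `SuperInt.InGraph`. -/
def graph (e : ℕ) : ℕ := 4 * e + 3

/-- The sentence `∃ x P_0(x)` that plays the role of falsity. -/
def fals : Formula := ex 0 (lit 0 0)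

/-- "The tuple `j ↦ v (ρ j)`, `j ≤ n`, belongs to the `e`-th graph", written with the bound
variable `u`. -/
def call (v u : ℕ) (ρ : ℕ → ℕ) (n e : ℕ) : Formula :=
  ex u (and (conjTo (n + 1) fun j => eqv (coord j) u (coord (ρ j)) v) (lit (graph e) u))

/-- The Horn clause `∀ x (φ → x ∈ e)`. -/
def clause (φ : Formula) (e : ℕ) : Formula := all 0 (imp φ (lit (graph e) 0))

theorem inFragment_lit {k x : ℕ} : InFragment (lit k x) ↔ x < 2 := by
  simp [lit, InFragment]

theorem inFragment_conj {l : List Formula} : InFragment (conj l) ↔ ∀ φ ∈ l, InFragment φ := by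
  induction l with
  | nil => simp [conj, InFragment]
  | cons a l ih => simpa [conj, InFragment] using fun _ => ih

theorem inFragment_conjTo {n : ℕ} {φ : ℕ → Formula} :
    InFragment (conjTo n φ) ↔ ∀ j < n, InFragment (φ j) := by
  simp [conjTo, inFragment_conj]

theorem inFragment_eqv {k x l y : ℕ} : InFragment (eqv k x l y) ↔ x < 2 ∧ y < 2 := by
  simp [eqv, InFragment, inFragment_lit]; tauto

theorem inFragment_fals : InFragment fals := by simp [fals, InFragment, inFragment_lit]

theorem inFragment_call {v u : ℕ} {ρ : ℕ → ℕ} {n e : ℕ} (hv : v < 2) (hu : u < 2) :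
    InFragment (call v u ρ n e) := by
  simp [call, InFragment, inFragment_lit, inFragment_conjTo, inFragment_eqv, hv, hu]

theorem inFragment_clause {φ : Formula} {e : ℕ} : InFragment (clause φ e) ↔ InFragment φ := by
  simp [clause, InFragment, inFragment_lit]

end Formula

/-! ### Truth values of unary letters -/

section Forcing

variable {W : Type u} [PartialOrder W] {A : AugFrame.{u, v} W} (M : A.Interp)

/-- The truth of the `k`-th unary letter on the individual `d` at the world `w`. -/
def At (w : W) (k : ℕ) (d : A.Ind) : Prop := (fun _ => d) ∈ M.I w 1 k

/-- Two letters have the same truth value on two individuals, as seen from the world `w`. -/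
def Eqv (w : W) (k : ℕ) (d : A.Ind) (l : ℕ) (e : A.Ind) : Prop :=
  ∀ v, w ≤ v → (At M v k d ↔ At M v l e)

variable {M}

theorem At.mono {w v : W} {k : ℕ} {d : A.Ind} (h : At M w k d) (hv : w ≤ v) : At M v k d :=
  M.heredity w v hv _ _ h

theorem Eqv.refl {w : W} {k : ℕ} (d : A.Ind) : Eqv M w k d k d := fun _ _ => Iff.rfl

theorem Eqv.symm {w : W} {k l : ℕ} {d e : A.Ind} (h : Eqv M w k d l e) : Eqv M w l e k d :=
  fun v hv => (h v hv).symm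

theorem Eqv.trans {w : W} {k l m : ℕ} {d e f : A.Ind} (h : Eqv M w k d l e)
    (h' : Eqv M w l e m f) : Eqv M w k d m f :=
  fun v hv => (h v hv).trans (h' v hv)

theorem eqv_of_at {w : W} {k l : ℕ} {d e : A.Ind} (h : At M w k d) (h' : At M w l e) :
    Eqv M w k d l e :=
  fun _ hv => iff_of_true (h.mono hv) (h'.mono hv)

theorem forces_lit {w : W} {g : ℕ → A.Ind} {k x : ℕ} :
    M.Forces w g (lit k x) ↔ At M w k (g x) := Iff.rfl

theorem forces_conj {w : W} {g : ℕ → A.Ind} {l : List Formula} :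
    M.Forces w g (conj l) ↔ ∀ φ ∈ l, M.Forces w g φ := by
  induction l with
  | nil => simp [conj, AugFrame.Interp.Forces]
  | cons a l ih => simpa [conj, AugFrame.Interp.Forces] using fun _ => ih

theorem forces_conjTo {w : W} {g : ℕ → A.Ind} {n : ℕ} {φ : ℕ → Formula} :
    M.Forces w g (conjTo n φ) ↔ ∀ j < n, M.Forces w g (φ j) := by
  simp [conjTo, forces_conj]

theorem forces_eqv {w : W} {g : ℕ → A.Ind} {k x l y : ℕ} :
    M.Forces w g (eqv k x l y) ↔ Eqv M w k (g x) l (g y) :=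
  ⟨fun h v hv => ⟨h.1 v hv, h.2 v hv⟩, fun h => ⟨fun v hv => (h v hv).1, fun v hv => (h v hv).2⟩⟩

/-- A universally quantified formula at the world itself. -/
theorem forces_of_all {w : W} {g : ℕ → A.Ind} {x : ℕ} {φ : Formula} (h : M.Forces w g (all x φ))
    {d : A.Ind} (hd : d ∈ A.D w) : M.Forces w (Function.update g x d) φ :=
  h w le_rfl d hd

theorem forces_of_clause {w : W} {g : ℕ → A.Ind} {φ : Formula} {e : ℕ}
    (h : M.Forces w g (clause φ e)) {d : A.Ind} (hd : d ∈ A.D w)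
    (hφ : M.Forces w (Function.update g 0 d) φ) : At M w (graph e) d := by
  have := forces_of_all h hd w le_rfl hφ
  simpa [forces_lit] using this

theorem forces_fals_iff {w : W} {g g' : ℕ → A.Ind} : M.Forces w g fals ↔ M.Forces w g' fals := by
  simp [fals, AugFrame.Interp.Forces, forces_lit]

end Forcing

/-! ### Coding tuples of numbers by individuals -/

namespace Formula

/-- The axiom providing, for each individual, another one in which the `j`-th of the first `K`
coordinates is increased by one. -/
def incAx (K j : ℕ) : Formula :=
  all 0 (ex 1 (conjTo K fun i => eqv (coord i) 1 (if i = j then next i else coord i) 0))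

/-- The axiom stating that the successor of a `j`-th coordinate is determined in the same way as
that of a `0`-th coordinate. The premise of the intended implication is negated with `fals`, so
that an equivalence only counts if it holds at the world of evaluation. -/
def funAx (j : ℕ) : Formula :=
  all 0 (all 1 (or (imp (eqv (coord j) 0 (coord 0) 1) fals) (eqv (next j) 0 (next 0) 1)))

/-- The axioms on the first `K` coordinates; they make all tuples of `K` numbers available. -/
def tupleAx (K : ℕ) : Formula :=
  and (ex 0 (conjTo K fun j => lit (coord j) 0)) (and (conjTo K (incAx K)) (conjTo K funAx))

theorem inFragment_tupleAx (K : ℕ) : InFragment (tupleAx K) := by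
  simp [tupleAx, incAx, funAx, InFragment, inFragment_conjTo, inFragment_lit, inFragment_eqv,
    inFragment_fals]

end Formula

section Tuples

variable {W : Type u} [PartialOrder W] {A : AugFrame.{u, v} W} (M : A.Interp)

/-- The `j`-th coordinate of `d` is the number `m`, where numbers are the truth values of the
`0`-th coordinates of the members of the sequence `z`. -/
def HasCoord (w : W) (z : ℕ → A.Ind) (d : A.Ind) (j m : ℕ) : Prop :=
  Eqv M w (coord j) d (coord 0) (z m)

/-- The individuals `z m` represent the numbers at the world `w`, and each tuple of `K` numbers is
coded by an individual of `w`. -/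
structure Numerals (w : W) (z : ℕ → A.Ind) (K : ℕ) : Prop where
  zero : At M w (coord 0) (z 0)
  succ : ∀ m, Eqv M w (next 0) (z m) (coord 0) (z (m + 1))
  next_eq : ∀ d ∈ A.D w, ∀ j < K, ∀ m, HasCoord M w z d j m → Eqv M w (next j) d (next 0) (z m)
  tuple : ∀ a : ℕ → ℕ, ∃ d ∈ A.D w, ∀ j < K, HasCoord M w z d j (a j)

variable {M}

theorem Numerals.of_le {w : W} {z : ℕ → A.Ind} {K L : ℕ} (h : Numerals M w z L) (hK : K ≤ L) :
    Numerals M w z K where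
  zero := h.zero
  succ := h.succ
  next_eq d hd j hj := h.next_eq d hd j (hj.trans_le hK)
  tuple a := (h.tuple a).imp fun _ hd => ⟨hd.1, fun j hj => hd.2 j (hj.trans_le hK)⟩

theorem HasCoord.at_zero {w : W} {z : ℕ → A.Ind} {K : ℕ} (h : Numerals M w z K) {d : A.Ind}
    {j : ℕ} (hd : HasCoord M w z d j 0) : At M w (coord j) d :=
  (hd w le_rfl).2 h.zero

theorem Numerals.next_eqv {w : W} {z : ℕ → A.Ind} {K : ℕ} (h : Numerals M w z K) {d e : A.Ind}
    {i j m : ℕ} (hdD : d ∈ A.D w) (hi : i < K) (hd : HasCoord M w z d i m)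
    (he : HasCoord M w z e j (m + 1)) : Eqv M w (next i) d (coord j) e :=
  ((h.next_eq d hdD i hi m hd).trans (h.succ m)).trans he.symm

theorem HasCoord.eqv {w : W} {z : ℕ → A.Ind} {d e : A.Ind} {i j m n : ℕ}
    (hd : HasCoord M w z d i m) (he : HasCoord M w z e j n) (hmn : m = n) :
    Eqv M w (coord i) d (coord j) e :=
  hd.trans (hmn ▸ he.symm)

/-- In every model, the axioms on coordinates make sure that tuples of numbers are available, as
long as `fals` is not true. -/
theorem exists_numerals {w : W} {g : ℕ → A.Ind} {K : ℕ} (hK : 0 < K)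
    (h : M.Forces w g (tupleAx K)) (hf : ¬ M.Forces w g fals) : ∃ z, Numerals M w z K := by
  obtain ⟨⟨d₀, hd₀, h₀⟩, hinc, hfun⟩ := h
  rw [forces_conjTo] at h₀ hinc hfun
  have h₀' : ∀ j < K, At M w (coord j) d₀ := fun j hj => by
    simpa [forces_lit] using h₀ j hj
  have hinc' : ∀ j < K, ∀ d ∈ A.D w, ∃ e ∈ A.D w,
      ∀ i < K, Eqv M w (coord i) e (if i = j then next i else coord i) d := by
    intro j hj d hd
    obtain ⟨e, he, h⟩ := forces_of_all (hinc j hj) hd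
    refine ⟨e, he, fun i hi => ?_⟩
    have := forces_eqv.1 (forces_conjTo.1 h i hi)
    simpa using this
  have hfun' : ∀ j < K, ∀ d ∈ A.D w, ∀ e ∈ A.D w, Eqv M w (coord j) d (coord 0) e →
      Eqv M w (next j) d (next 0) e := by
    intro j hj d hd e he hde
    rcases forces_of_all (forces_of_all (hfun j hj) hd) he with h | h
    · refine absurd (forces_fals_iff.1 (h w le_rfl (forces_eqv.2 ?_))) hf
      simpa using hde
    · simpa using forces_eqv.1 h
  -- The numerals are obtained by iterating the increment of the `0`-th coordinate.
  choose! F hFD hF using hinc' 0 hK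
  let z : ℕ → A.Ind := fun m => F^[m] d₀
  have hzs : ∀ m, z (m + 1) = F (z m) := fun m => Function.iterate_succ_apply' F m d₀
  have hz : ∀ m, z m ∈ A.D w := by
    intro m
    induction m with
    | zero => exact hd₀
    | succ m ih => rw [hzs]; exact hFD _ ih
  have hsucc : ∀ m, Eqv M w (next 0) (z m) (coord 0) (z (m + 1)) := fun m => by
    rw [hzs]; simpa using (hF _ (hz m) 0 hK).symm
  have hnext : ∀ d ∈ A.D w, ∀ j < K, ∀ m, HasCoord M w z d j m →
      Eqv M w (next j) d (next 0) (z m) :=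
    fun d hd j hj m hm => hfun' j hj d hd _ (hz m) hm
  refine ⟨z, h₀' 0 hK, hsucc, hnext, ?_⟩
  -- Tuples supported on the first `L` coordinates, by induction on `L` and on the last coordinate.
  have key : ∀ L ≤ K, ∀ a : ℕ → ℕ, (∀ j, L ≤ j → a j = 0) →
      ∃ d ∈ A.D w, ∀ j < K, HasCoord M w z d j (a j) := by
    intro L
    induction L with
    | zero =>
      intro _ a ha
      refine ⟨d₀, hd₀, fun j hj => ?_⟩
      rw [ha j (Nat.zero_le j)]
      exact eqv_of_at (h₀' j hj) (h₀' 0 hK)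
    | succ L ih =>
      intro hL a ha
      have step : ∀ m, ∃ d ∈ A.D w, ∀ j < K, HasCoord M w z d j (Function.update a L m j) := by
        intro m
        induction m with
        | zero =>
          refine ih (by omega) _ fun j hj => ?_
          rcases eq_or_ne j L with rfl | hne
          · simp
          · rw [Function.update_of_ne hne]; exact ha j (by omega)
        | succ m ihm =>
          obtain ⟨d, hd, hda⟩ := ihm
          obtain ⟨e, he, hed⟩ := hinc' L (by omega) d hd
          refine ⟨e, he, fun j hj => ?_⟩
          have h1 := hed j hj
          have h2 := hda j hj
          rcases eq_or_ne j L with rfl | hne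
          · rw [if_pos rfl] at h1
            rw [Function.update_self] at h2 ⊢
            exact (h1.trans (hnext d hd j hj m h2)).trans (hsucc m)
          · rw [if_neg hne] at h1
            rw [Function.update_of_ne hne] at h2 ⊢
            exact h1.trans h2
      simpa using step (a L)
  intro a
  obtain ⟨d, hd, hda⟩ := key K le_rfl (fun j => if j < K then a j else 0)
    fun j hj => if_neg (by omega)
  exact ⟨d, hd, fun j hj => by simpa [hj] using hda j hj⟩

/-- If the `e`-th graph letter is true on all individuals that code the tuple `a ∘ ρ`, then the
corresponding call is true on individuals coding `a`. -/
theorem forces_call {w : W} {z : ℕ → A.Ind} {K n e v u : ℕ} {ρ a : ℕ → ℕ} {g : ℕ → A.Ind}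
    (h : Numerals M w z K) (hn : n < K) (huv : v ≠ u)
    (he : ∀ d ∈ A.D w, (∀ j ≤ n, HasCoord M w z d j (a (ρ j))) → At M w (graph e) d)
    (hg : ∀ j ≤ n, HasCoord M w z (g v) (ρ j) (a (ρ j))) : M.Forces w g (call v u ρ n e) := by
  obtain ⟨d, hd, hda⟩ := h.tuple fun j => a (ρ j)
  refine ⟨d, hd, forces_conjTo.2 fun j hj => forces_eqv.2 ?_, ?_⟩
  · rw [Function.update_self, Function.update_of_ne huv]
    exact (hda j (by omega)).eqv (hg j (by omega)) rfl
  · rw [forces_lit, Function.update_self]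
    exact he d hd fun j hj => hda j (by omega)

end Tuples

/-! ### The countermodel -/

/-- The tuple of the first `n` coordinates. -/
def firstCoords (n : ℕ) (x : ℕ → ℕ) : List.Vector ℕ n := List.Vector.ofFn fun i => x i

/-- The set of tuples with number `e = ⟨n, c⟩`: the graph of the `n`-ary partial function computed
by the `c`-th program, the value being the `n`-th coordinate. -/
def InGraph (e : ℕ) (x : ℕ → ℕ) : Prop :=
  x e.unpair.1 ∈ (Denumerable.ofNat Nat.Partrec.Code e.unpair.2).eval
    (Encodable.encode (firstCoords e.unpair.1 x))

theorem exists_inGraph_iff {n : ℕ} {f : List.Vector ℕ n → ℕ} (hf : Nat.Primrec' f) :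
    ∃ e, ∀ x, InGraph e x ↔ x n = f (firstCoords n x) := by
  have h : Computable f := (Nat.Primrec'.prim_iff.1 hf).to_comp
  obtain ⟨c, hc⟩ := Nat.Partrec.Code.exists_code.1 h
  refine ⟨Nat.pair n (Encodable.encode c), fun x => ?_⟩
  unfold InGraph
  rw [Nat.unpair_pair]
  simp [hc]

open Classical in
/-- The number that is the value of the `k`-th unary letter on a tuple in the countermodel. The
number `0` stands for truth; letters of graphs that are not true get the value `1`, which is the
value of `fals`. -/
noncomputable def letterVal (x : ℕ → ℕ) (k : ℕ) : ℕ :=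
  if k % 4 = 1 then x (k / 4)
  else if k % 4 = 2 then x (k / 4) + 1
  else if k % 4 = 3 ∧ InGraph (k / 4) x then 0
  else 1

theorem letterVal_coord (x : ℕ → ℕ) (j : ℕ) : letterVal x (coord j) = x j := by
  have h1 : (4 * j + 1) % 4 = 1 := by omega
  have h2 : (4 * j + 1) / 4 = j := by omega
  simp [letterVal, coord, h1, h2]

theorem letterVal_next (x : ℕ → ℕ) (j : ℕ) : letterVal x (next j) = x j + 1 := by
  have h1 : (4 * j + 2) % 4 = 2 := by omega
  have h2 : (4 * j + 2) / 4 = j := by omega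
  simp [letterVal, next, h1, h2]

theorem letterVal_graph_le (x : ℕ → ℕ) (e : ℕ) : letterVal x (graph e) ≤ 1 := by
  have h1 : (4 * e + 3) % 4 = 3 := by omega
  simp only [letterVal, graph, h1]
  split_ifs <;> simp_all

theorem letterVal_graph_eq_zero {x : ℕ → ℕ} {e : ℕ} : letterVal x (graph e) = 0 ↔ InGraph e x := by
  have h1 : (4 * e + 3) % 4 = 3 := by omega
  have h2 : (4 * e + 3) / 4 = e := by omega
  simp only [letterVal, graph, h1, h2]
  split_ifs <;> simp_all

theorem letterVal_zero (x : ℕ → ℕ) : letterVal x 0 = 1 := by simp [letterVal]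

/-- The augmented frame whose individuals at all worlds are the tuples of numbers. -/
def tupleFrame (W : Type u) [PartialOrder W] : AugFrame.{u, v} W where
  Ind := ULift.{v} (ℕ → ℕ)
  D _ := Set.univ
  nonempty _ := Set.univ_nonempty
  expanding _ _ _ := subset_rfl

/-- The tuple that an individual of `tupleFrame` is. -/
def tup {W : Type u} [PartialOrder W] (d : (tupleFrame.{u, v} W).Ind) : ℕ → ℕ := ULift.down d

/-- A tuple as an individual of `tupleFrame`. -/
def ofTup {W : Type u} [PartialOrder W] (x : ℕ → ℕ) : (tupleFrame.{u, v} W).Ind := ULift.up x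

theorem tup_ofTup {W : Type u} [PartialOrder W] (x : ℕ → ℕ) :
    tup (ofTup.{u, v} (W := W) x) = x := rfl

section Countermodel

variable {W : Type u} [LinearOrder W] (s : ℕ → W)

/-- The countermodel built on the chain `s 0 < s 1 < …`: a unary letter with value `m` on a tuple
becomes true on it at the world `s m`. -/
noncomputable def tupleModel : (tupleFrame.{u, v} W).Interp where
  I v n k := {a | ∃ i : Fin n, s (letterVal (tup (a i)) k) ≤ v}
  on_domain _ _ _ _ _ _ := Set.mem_univ _
  heredity _ _ h _ _ := fun _ ⟨i, hi⟩ => ⟨i, hi.trans h⟩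

variable {s} {v : W} {g : ℕ → (tupleFrame.{u, v} W).Ind}

theorem at_tupleModel {k : ℕ} {x : (tupleFrame.{u, v} W).Ind} :
    At (tupleModel s) v k x ↔ s (letterVal (tup x) k) ≤ v :=
  ⟨fun ⟨_, h⟩ => h, fun h => ⟨0, h⟩⟩

theorem eqv_tupleModel_of_eq {k l : ℕ} {x y : (tupleFrame.{u, v} W).Ind}
    (h : letterVal (tup x) k = letterVal (tup y) l) : Eqv (tupleModel s) v k x l y :=
  fun _ _ => by rw [at_tupleModel, at_tupleModel, h]

theorem forces_fals_tupleModel : (tupleModel s).Forces v g fals ↔ s 1 ≤ v := by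
  constructor
  · rintro ⟨d, -, hd⟩
    have := at_tupleModel.1 (forces_lit.1 hd)
    rwa [letterVal_zero] at this
  · intro h
    refine ⟨ofTup fun _ => 0, Set.mem_univ _, forces_lit.2 (at_tupleModel.2 ?_)⟩
    rwa [letterVal_zero]

/-- Between `s 0` and `s 1`, letters are true exactly when their value is `0`. -/
theorem at_tupleModel_iff_eq_zero (hs : StrictMono s) (h0 : s 0 ≤ v) (h1 : ¬ s 1 ≤ v) {k : ℕ}
    {x : (tupleFrame.{u, v} W).Ind} : At (tupleModel s) v k x ↔ letterVal (tup x) k = 0 := by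
  rw [at_tupleModel]
  refine ⟨fun h => ?_, fun h => by rwa [h]⟩
  by_contra hne
  exact h1 ((hs.monotone (by omega)).trans h)

/-- Before `s 1`, equivalence of letters is equality of their values. -/
theorem eqv_tupleModel_iff (hs : StrictMono s) (h1 : ¬ s 1 ≤ v) {k l : ℕ}
    {x y : (tupleFrame.{u, v} W).Ind} :
    Eqv (tupleModel s) v k x l y ↔ letterVal (tup x) k = letterVal (tup y) l := by
  refine ⟨fun h => ?_, eqv_tupleModel_of_eq⟩
  have aux : ∀ a b : ℕ, (∀ u, v ≤ u → s a ≤ u → s b ≤ u) → b ≤ a := by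
    intro a b hab
    by_contra! hlt
    -- As `s 1 ≤ s b`, the letter with value `b` is false both at `v` and at `s a`.
    have := hab (max v (s a)) (le_max_left _ _) (le_max_right _ _)
    rcases le_max_iff.1 this with h | h
    · exact h1 ((hs.monotone (by omega)).trans h)
    · exact absurd (hs.le_iff_le.1 h) (by omega)
  refine le_antisymm (aux _ _ fun u hu => ?_) (aux _ _ fun u hu => ?_)
  · have := (h u hu).2; rwa [at_tupleModel, at_tupleModel] at this
  · have := (h u hu).1; rwa [at_tupleModel, at_tupleModel] at this

theorem forces_tupleAx_tupleModel (hs : StrictMono s) (h0 : s 0 ≤ v) (K : ℕ) :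
    (tupleModel s).Forces v g (tupleAx K) := by
  refine ⟨⟨ofTup fun _ => 0, Set.mem_univ _, forces_conjTo.2 fun j _ => ?_⟩,
    forces_conjTo.2 fun j _ => ?_, forces_conjTo.2 fun j _ => ?_⟩
  · rw [forces_lit, at_tupleModel, letterVal_coord, Function.update_self]
    exact h0
  · intro u _ d _
    refine ⟨ofTup (Function.update (tup d) j (tup d j + 1)), Set.mem_univ _,
      forces_conjTo.2 fun i _ => forces_eqv.2 (eqv_tupleModel_of_eq ?_)⟩
    rcases eq_or_ne i j with rfl | hne
    · simp [letterVal_coord, letterVal_next, tup_ofTup]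
    · simp [letterVal_coord, hne, tup_ofTup]
  · intro u hu d _ u' hu' e _
    rw [AugFrame.Interp.Forces, forces_eqv]
    -- If the numbers are equal, so are their successors at all worlds; if they differ, their
    -- equivalence can only hold from `s 1` on, where `fals` is true.
    by_cases hde : tup d j = tup e 0
    · right
      apply eqv_tupleModel_of_eq
      simp [letterVal_next, hde]
    · left
      intro t ht hte
      rw [forces_fals_tupleModel]
      by_contra h1
      rw [forces_eqv, eqv_tupleModel_iff hs h1] at hte
      simp [letterVal_coord, hde] at hte

/-- A clause is true in the countermodel if it is classically sound between `s 0` and `s 1`; from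
`s 1` on, all graph letters are true. -/
theorem forces_clause_tupleModel {φ : Formula} {e : ℕ} (hs : StrictMono s) (h0 : s 0 ≤ v)
    (h : ∀ u (d : (tupleFrame.{u, v} W).Ind), s 0 ≤ u → ¬ s 1 ≤ u →
      (tupleModel s).Forces u (Function.update g 0 d) φ → InGraph e (tup d)) :
    (tupleModel s).Forces v g (clause φ e) := by
  intro u hu d _ t ht hφ
  rw [forces_lit, Function.update_self, at_tupleModel]
  by_cases h1 : s 1 ≤ t
  · exact (hs.monotone (letterVal_graph_le _ _)).trans h1
  · have h0' := (h0.trans hu).trans ht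
    rwa [letterVal_graph_eq_zero.2 (h t d h0' h1 hφ)]

theorem value_of_forces_call {n e x y : ℕ} {ρ : ℕ → ℕ} {f : List.Vector ℕ n → ℕ}
    (hs : StrictMono s) (h0 : s 0 ≤ v) (h1 : ¬ s 1 ≤ v) (hxy : x ≠ y)
    (hf : ∀ x, InGraph e x ↔ x n = f (firstCoords n x))
    (h : (tupleModel s).Forces v g (call x y ρ n e)) :
    tup (g x) (ρ n) = f (List.Vector.ofFn fun i => tup (g x) (ρ i)) := by
  obtain ⟨d, -, hd, he⟩ := h
  rw [forces_lit, Function.update_self, at_tupleModel_iff_eq_zero hs h0 h1,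
    letterVal_graph_eq_zero, hf] at he
  have hd' : ∀ j ≤ n, tup d j = tup (g x) (ρ j) := by
    intro j hj
    have := forces_eqv.1 (forces_conjTo.1 hd j (by omega))
    rw [eqv_tupleModel_iff hs h1, letterVal_coord, letterVal_coord, Function.update_self,
      Function.update_of_ne hxy] at this
    exact this
  rw [← hd' n le_rfl, he, firstCoords]
  congr 2
  funext i
  exact hd' i i.2.le

end Countermodel

/-! ### Axioms for primitive recursive functions -/

theorem firstCoords_succ (n : ℕ) (x : ℕ → ℕ) :
    firstCoords (n + 1) x = x 0 ::ᵥ firstCoords n fun j => x (j + 1) := rfl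

section Primrec

variable {W : Type u} [LinearOrder W] (s : ℕ → W)

/-- The formula `Γ` axiomatizes the graph of the `n`-ary function `f`, denoted by the `e`-th graph
letter, using tuples of `K` numbers: it is true in the countermodel, and in any model it makes the
letter true on all tuples from the graph. -/
structure Axiomatizes (Γ : Formula) (K e n : ℕ) (f : List.Vector ℕ n → ℕ) : Prop where
  inFragment : Γ.InFragment
  lt : n < K
  inGraph_iff : ∀ x, InGraph e x ↔ x n = f (firstCoords n x)
  sound : ∀ (v : W) (g : ℕ → (tupleFrame.{u, v} W).Ind), s 0 ≤ v → (tupleModel s).Forces v g Γ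
  complete : ∀ (A : AugFrame.{u, v} W) (M : A.Interp) (w : W) (g : ℕ → A.Ind) (z : ℕ → A.Ind),
    Numerals M w z K → M.Forces w g Γ → ∀ a : ℕ → ℕ, a n = f (firstCoords n a) →
      ∀ d ∈ A.D w, (∀ j ≤ n, HasCoord M w z d j (a j)) → At M w (graph e) d

variable {s}

theorem Axiomatizes.forces_call {Γ : Formula} {K e n : ℕ} {f : List.Vector ℕ n → ℕ}
    (h : Axiomatizes.{u, v} s Γ K e n f) {A : AugFrame.{u, v} W} {M : A.Interp} {w : W}
    {g g' z : ℕ → A.Ind} {L x y : ℕ} {ρ a : ℕ → ℕ} (hz : Numerals M w z L) (hL : K ≤ L)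
    (hΓ : M.Forces w g' Γ) (hxy : x ≠ y)
    (ha : a (ρ n) = f (List.Vector.ofFn fun i => a (ρ i)))
    (hg : ∀ j ≤ n, HasCoord M w z (g x) (ρ j) (a (ρ j))) : M.Forces w g (call x y ρ n e) :=
  SuperInt.forces_call (hz.of_le hL) h.lt hxy
    (h.complete A M w g' z (hz.of_le hL) hΓ (fun j => a (ρ j)) ha) hg

/-- A function whose graph is described by a single clause without calls. -/
theorem Axiomatizes.of_clause {n : ℕ} {f : List.Vector ℕ n → ℕ} (hf : Nat.Primrec' f)
    (hs : StrictMono s) (φ : Formula) (hφ : φ.InFragment)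
    (sound : ∀ (v : W) (g : ℕ → (tupleFrame.{u, v} W).Ind), s 0 ≤ v → ¬ s 1 ≤ v →
      (tupleModel s).Forces v g φ → tup (g 0) n = f (firstCoords n (tup (g 0))))
    (complete : ∀ (A : AugFrame.{u, v} W) (M : A.Interp) (w : W) (g : ℕ → A.Ind) (z : ℕ → A.Ind),
      Numerals M w z (n + 1) → ∀ a : ℕ → ℕ, a n = f (firstCoords n a) → g 0 ∈ A.D w →
      (∀ j ≤ n, HasCoord M w z (g 0) j (a j)) → M.Forces w g φ) :
    ∃ Γ K e, Axiomatizes.{u, v} s Γ K e n f := by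
  obtain ⟨e, he⟩ := exists_inGraph_iff hf
  refine ⟨clause φ e, n + 1, e, inFragment_clause.2 hφ, n.lt_succ_self, he, fun v g h0 => ?_,
    fun A M w g z hz hΓ a ha d hd hda => forces_of_clause hΓ hd ?_⟩
  · refine forces_clause_tupleModel hs h0 fun u d h0 h1 h => (he _).2 ?_
    simpa using sound _ _ h0 h1 h
  · exact complete _ _ _ _ z hz a ha (by simpa using hd) (by simpa using hda)

theorem exists_axiomatizes_zero (hs : StrictMono s) :
    ∃ Γ K e, Axiomatizes.{u, v} s Γ K e 0 fun _ => 0 := by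
  refine Axiomatizes.of_clause .zero hs (lit (coord 0) 0) (inFragment_lit.2 two_pos) ?_ ?_
  · intro v g h0 h1 h
    rwa [forces_lit, at_tupleModel_iff_eq_zero hs h0 h1, letterVal_coord] at h
  · intro A M w g z hz a ha _ hda
    have := hda 0 le_rfl
    rw [ha] at this
    exact this.at_zero hz

theorem exists_axiomatizes_succ (hs : StrictMono s) :
    ∃ Γ K e, Axiomatizes.{u, v} s Γ K e 1 fun v => Nat.succ v.head := by
  refine Axiomatizes.of_clause .succ hs (eqv (next 0) 0 (coord 1) 0)
    (inFragment_eqv.2 (by simp)) ?_ ?_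
  · intro v g h0 h1 h
    rw [forces_eqv, eqv_tupleModel_iff hs h1, letterVal_coord, letterVal_next] at h
    exact h.symm
  · intro A M w g z hz a ha hd hda
    have := hda 1 le_rfl
    rw [ha] at this
    exact forces_eqv.2 (hz.next_eqv hd (by simp) (hda 0 zero_le_one) this)

theorem exists_axiomatizes_get (hs : StrictMono s) {n : ℕ} (i : Fin n) :
    ∃ Γ K e, Axiomatizes.{u, v} s Γ K e n fun v => v.get i := by
  refine Axiomatizes.of_clause (.get i) hs (eqv (coord i) 0 (coord n) 0)
    (inFragment_eqv.2 (by simp)) ?_ ?_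
  · intro v g h0 h1 h
    rw [forces_eqv, eqv_tupleModel_iff hs h1, letterVal_coord, letterVal_coord] at h
    simp [firstCoords, h]
  · intro A M w g z hz a ha _ hda
    refine forces_eqv.2 ((hda i i.2.le).eqv (hda n le_rfl) ?_)
    simp [ha, firstCoords]

/-- The body of the clause for a composition of an `n`-ary function with `m`-ary functions. It
asks for an auxiliary tuple that extends the given one by the `n` intermediate values. -/
def compBody (m n e : ℕ) (e' : Fin n → ℕ) : Formula :=
  ex 1 (and (conjTo (m + 1) fun j => eqv (coord j) 1 (coord j) 0)
    (and (call 1 0 (fun j => if j < n then m + 1 + j else m) n e)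
      (conj (List.ofFn fun i => call 1 0 (fun j => if j < m then j else m + 1 + i) m (e' i)))))

theorem exists_axiomatizes_comp (hs : StrictMono s) {m n : ℕ} {f : List.Vector ℕ n → ℕ}
    {f' : Fin n → List.Vector ℕ m → ℕ} (hf : Nat.Primrec' f) (hf' : ∀ i, Nat.Primrec' (f' i))
    (ih : ∃ Γ K e, Axiomatizes.{u, v} s Γ K e n f)
    (ih' : ∀ i, ∃ Γ K e, Axiomatizes.{u, v} s Γ K e m (f' i)) :
    ∃ Γ K e, Axiomatizes.{u, v} s Γ K e m fun a => f (List.Vector.ofFn fun i => f' i a) := by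
  obtain ⟨Γ, K, e, h⟩ := ih
  choose Γ' K' e' h' using ih'
  obtain ⟨r, hr⟩ := exists_inGraph_iff (Nat.Primrec'.comp f' hf hf')
  have hK' : ∀ i, K' i ≤ ∑ i, K' i := fun i =>
    Finset.single_le_sum (fun _ _ => Nat.zero_le _) (Finset.mem_univ i)
  refine ⟨and (clause (compBody m n e e') r) (and Γ (conj (List.ofFn Γ'))),
    m + 1 + n + K + ∑ i, K' i, r, ⟨?_, h.inFragment, ?_⟩, by omega, hr, fun v g h0 => ⟨?_, ?_, ?_⟩,
    ?_⟩
  · simp [inFragment_clause, compBody, InFragment, inFragment_conjTo, inFragment_conj,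
      inFragment_eqv, inFragment_call]
  · simpa [inFragment_conj, List.forall_mem_ofFn_iff] using fun i => (h' i).inFragment
  · refine forces_clause_tupleModel hs h0 fun u d h0 h1 hφ => (hr _).2 ?_
    obtain ⟨y, -, hy, hcall, hcalls⟩ := hφ
    rw [forces_conj, List.forall_mem_ofFn_iff] at hcalls
    have hyd : ∀ j ≤ m, tup y j = tup d j := by
      intro j hj
      have := forces_eqv.1 (forces_conjTo.1 hy j (by omega))
      rw [eqv_tupleModel_iff hs h1, letterVal_coord, letterVal_coord] at this
      simpa using this
    have hm := value_of_forces_call hs h0 h1 one_ne_zero h.inGraph_iff hcall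
    have hi := fun i => value_of_forces_call hs h0 h1 one_ne_zero (h' i).inGraph_iff (hcalls i)
    simp only [Function.update_self, lt_irrefl, if_false, Fin.is_lt, if_true] at hm hi
    rw [← hyd m le_rfl, hm]
    congr 2
    funext i
    rw [hi, firstCoords]
    congr 2
    funext j
    exact hyd j j.2.le
  · exact h.sound v g h0
  · rw [forces_conj, List.forall_mem_ofFn_iff]
    exact fun i => (h' i).sound v g h0
  · rintro A M w g z hz ⟨hcl, hΓ, hΓ'⟩ a ha d hd hda
    rw [forces_conj, List.forall_mem_ofFn_iff] at hΓ'
    refine forces_of_clause hcl hd ?_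
    let b : ℕ → ℕ := fun j => if j ≤ m then a j else
      if hj : j - (m + 1) < n then f' ⟨j - (m + 1), hj⟩ (firstCoords m a) else 0
    have hb : ∀ j ≤ m, b j = a j := fun j hj => if_pos hj
    have hb' : ∀ i : Fin n, b (m + 1 + i) = f' i (firstCoords m a) := by
      intro i
      simp [b, show ¬ m + 1 + (i : ℕ) ≤ m by omega]
    obtain ⟨y, hyD, hy⟩ := hz.tuple b
    refine ⟨y, hyD, forces_conjTo.2 fun j hj => forces_eqv.2 ?_, ?_, ?_⟩
    · simpa using (hy j (by omega)).eqv (hda j (by omega)) (hb j (by omega))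
    · refine h.forces_call (a := b) hz (by omega) hΓ one_ne_zero ?_ fun j hj => ?_
      · simp [hb, hb', ha]
      · simpa using hy _ (by split_ifs <;> omega)
    · rw [forces_conj, List.forall_mem_ofFn_iff]
      intro i
      refine (h' i).forces_call (a := b) hz ((hK' i).trans (by omega)) (hΓ' i) one_ne_zero ?_
        fun j hj => ?_
      · simp only [lt_irrefl, if_false, Fin.is_lt, if_true, hb', firstCoords]
        congr 2
        funext j
        exact (hb j j.2.le).symm
      · simpa using hy _ (by split_ifs <;> omega)

/-- The renaming of coordinates for the call of the step function of a primitive recursion: the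
auxiliary tuple has the predecessor as `0`-th coordinate, the previous value as coordinate
`n + 2`, and otherwise agrees with the given tuple. -/
def stepCoord (n : ℕ) : ℕ → ℕ
  | 0 => 0
  | 1 => n + 2
  | j + 2 => j + 1

theorem stepCoord_le {n j : ℕ} (hj : j ≤ n + 2) : stepCoord n j ≤ n + 2 := by
  match j with
  | 0 => simp [stepCoord]
  | 1 => simp [stepCoord]
  | j + 2 => simp only [stepCoord]; omega

/-- The renaming of coordinates for the recursive call of a primitive recursion. -/
def recCoord (n j : ℕ) : ℕ := if j = n + 1 then n + 2 else j

/-- The body of the clause for the value at zero of a function defined by primitive recursion. -/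
def precBodyZero (n e : ℕ) : Formula := and (lit (coord 0) 0) (call 0 1 (· + 1) n e)

/-- The body of the clause for the value at a successor of a function defined by primitive
recursion. -/
def precBodySucc (n e r : ℕ) : Formula :=
  ex 1 (and (and (conjTo (n + 1) fun j => eqv (coord (j + 1)) 1 (coord (j + 1)) 0)
      (eqv (next 0) 1 (coord 0) 0))
    (and (call 1 0 (stepCoord n) (n + 2) e) (call 1 0 (recCoord n) (n + 1) r)))

theorem exists_axiomatizes_prec (hs : StrictMono s) {n : ℕ} {f : List.Vector ℕ n → ℕ}
    {f' : List.Vector ℕ (n + 2) → ℕ} (hf : Nat.Primrec' f) (hf' : Nat.Primrec' f')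
    (ih : ∃ Γ K e, Axiomatizes.{u, v} s Γ K e n f)
    (ih' : ∃ Γ K e, Axiomatizes.{u, v} s Γ K e (n + 2) f') :
    ∃ Γ K e, Axiomatizes.{u, v} s Γ K e (n + 1) fun v : List.Vector ℕ (n + 1) =>
      v.head.rec (f v.tail) fun y IH => f' (y ::ᵥ IH ::ᵥ v.tail) := by
  obtain ⟨Γ, K, e, h⟩ := ih
  obtain ⟨Γ', K', e', h'⟩ := ih'
  obtain ⟨r, hr⟩ := exists_inGraph_iff (Nat.Primrec'.prec hf hf')
  let H : ℕ → List.Vector ℕ n → ℕ := fun m v => m.rec (f v) fun y IH => f' (y ::ᵥ IH ::ᵥ v)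
  have hstep : ∀ x : ℕ → ℕ, (List.Vector.ofFn fun i : Fin (n + 2) => x (stepCoord n i)) =
      x 0 ::ᵥ x (n + 2) ::ᵥ firstCoords n fun j => x (j + 1) := fun x => rfl
  have hrec : ∀ x : ℕ → ℕ, (List.Vector.ofFn fun i : Fin (n + 1) => x (recCoord n i)) =
      firstCoords (n + 1) x := by
    intro x
    rw [firstCoords]
    congr 1
    funext i
    rw [recCoord, if_neg i.2.ne]
  change ∀ x, InGraph r x ↔ x (n + 1) = H (x 0) (firstCoords n fun j => x (j + 1)) at hr
  refine ⟨and (and (clause (precBodyZero n e) r) (clause (precBodySucc n e' r) r)) (and Γ Γ'),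
    n + 3 + K + K', r, ⟨⟨?_, ?_⟩, h.inFragment, h'.inFragment⟩, by omega, hr,
    fun v g h0 => ⟨⟨?_, ?_⟩, h.sound v g h0, h'.sound v g h0⟩, ?_⟩
  · simp [inFragment_clause, precBodyZero, InFragment, inFragment_lit, inFragment_call]
  · simp [inFragment_clause, precBodySucc, InFragment, inFragment_conjTo, inFragment_eqv,
      inFragment_call]
  · refine forces_clause_tupleModel hs h0 fun u d h0 h1 hφ => (hr _).2 ?_
    obtain ⟨hzero, hcall⟩ := hφ
    have hv := value_of_forces_call hs h0 h1 zero_ne_one h.inGraph_iff hcall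
    rw [forces_lit, at_tupleModel_iff_eq_zero hs h0 h1, letterVal_coord] at hzero
    simp only [Function.update_self] at hv hzero
    rw [hv, hzero]
    rfl
  · refine forces_clause_tupleModel hs h0 fun u d h0 h1 hφ => (hr _).2 ?_
    obtain ⟨y, -, ⟨hy, hsucc⟩, hcall, hcall'⟩ := hφ
    have hyd : ∀ j ≤ n, tup y (j + 1) = tup d (j + 1) := by
      intro j hj
      have := forces_eqv.1 (forces_conjTo.1 hy j (by omega))
      rw [eqv_tupleModel_iff hs h1, letterVal_coord, letterVal_coord] at this
      simpa using this
    rw [forces_eqv, eqv_tupleModel_iff hs h1, letterVal_coord, letterVal_next] at hsucc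
    have hv := value_of_forces_call hs h0 h1 one_ne_zero h'.inGraph_iff hcall
    have hv' := value_of_forces_call hs h0 h1 one_ne_zero
      (f := fun v => H v.head v.tail) hr hcall'
    simp only [Function.update_self, Function.update_of_ne zero_ne_one] at hv hv' hsucc
    rw [hstep] at hv
    rw [recCoord, if_pos rfl] at hv'
    have hv'' : tup y (n + 2) = H (tup y 0) (firstCoords n fun j => tup y (j + 1)) := by
      rw [hv', hrec]
      rfl
    have htail : (firstCoords n fun j => tup y (j + 1)) = firstCoords n fun j => tup d (j + 1) := by
      rw [firstCoords, firstCoords]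
      congr 1
      funext i
      exact hyd i i.2.le
    rw [← hyd n le_rfl, ← hsucc]
    refine hv.trans ?_
    rw [hv'', htail]
  · rintro A M w g z hz ⟨⟨hcl, hcl'⟩, hΓ, hΓ'⟩
    have key : ∀ m, ∀ a : ℕ → ℕ, a 0 = m →
        a (n + 1) = H m (firstCoords n fun j => a (j + 1)) →
        ∀ d ∈ A.D w, (∀ j ≤ n + 1, HasCoord M w z d j (a j)) → At M w (graph r) d := by
      intro m
      induction m with
      | zero =>
        intro a h0 ha d hd hda
        refine forces_of_clause hcl hd ⟨?_, ?_⟩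
        · have := hda 0 (by omega)
          rw [h0] at this
          rw [forces_lit, Function.update_self]
          exact this.at_zero hz
        · refine h.forces_call (a := a) hz (by omega) hΓ zero_ne_one ha fun j hj => ?_
          simpa using hda (j + 1) (by omega)
      | succ m ih =>
        intro a h0 ha d hd hda
        refine forces_of_clause hcl' hd ?_
        let b : ℕ → ℕ := fun j => if j = 0 then m else if j = n + 2 then
          H m (firstCoords n fun j => a (j + 1)) else a j
        have hb0 : b 0 = m := rfl
        have hbn : b (n + 2) = H m (firstCoords n fun j => a (j + 1)) := by simp [b]
        have hb : ∀ j ≤ n, b (j + 1) = a (j + 1) := by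
          intro j hj
          simp [b, show j ≠ n + 1 by omega]
        have htail : (firstCoords n fun j => b (j + 1)) = firstCoords n fun j => a (j + 1) := by
          rw [firstCoords, firstCoords]
          congr 1
          funext i
          exact hb i i.2.le
        obtain ⟨y, hyD, hy⟩ := hz.tuple b
        refine ⟨y, hyD, ⟨forces_conjTo.2 fun j hj => forces_eqv.2 ?_, forces_eqv.2 ?_⟩, ?_, ?_⟩
        · simpa using (hy (j + 1) (by omega)).eqv (hda (j + 1) (by omega)) (hb j (by omega))
        · have h1 := hy 0 (by omega)
          have h2 := hda 0 (by omega)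
          rw [h0] at h2
          rw [Function.update_self, Function.update_of_ne zero_ne_one, Function.update_self]
          exact hz.next_eqv hyD (by omega) h1 h2
        · refine h'.forces_call (a := b) hz (by omega) hΓ' one_ne_zero ?_ fun j hj => ?_
          · rw [hstep, htail, hbn, hb0]
            exact (hb n le_rfl).trans ha
          · simpa using hy _ ((stepCoord_le hj).trans_lt (by omega))
        · refine SuperInt.forces_call (a := b) hz (by omega) one_ne_zero ?_ fun j hj => ?_
          · refine ih (fun j => b (recCoord n j)) ?_ ?_
            · simp [recCoord, hb0]
            · rw [recCoord, if_pos rfl, hbn, ← htail]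
              congr 1
              rw [firstCoords, firstCoords]
              congr 1
              funext i
              rw [recCoord, if_neg (by omega)]
          · have : recCoord n j < n + 3 := by rw [recCoord]; split_ifs <;> omega
            simpa using hy _ (by omega)
    intro a ha d hd hda
    exact key (a 0) a rfl ha d hd hda

/-- Every primitive recursive function is axiomatized by a formula of the fragment. -/
theorem exists_axiomatizes (hs : StrictMono s) {n : ℕ} {f : List.Vector ℕ n → ℕ}
    (hf : Nat.Primrec' f) : ∃ Γ K e, Axiomatizes.{u, v} s Γ K e n f := by
  induction hf with
  | zero => exact exists_axiomatizes_zero hs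
  | succ => exact exists_axiomatizes_succ hs
  | get i => exact exists_axiomatizes_get hs i
  | comp g hf hg ihf ihg => exact exists_axiomatizes_comp hs hf hg ihf ihg
  | prec hf hg ihf ihg => exact exists_axiomatizes_prec hs hf hg ihf ihg

end Primrec

/-! ### The reduction -/

namespace Formula

/-- "The `0`-th coordinate of the individual `0` is `N`". -/
def numEq : ℕ → Formula
  | 0 => lit (coord 0) 0
  | N + 1 => ex 1 (and (eqv (next 0) 1 (coord 0) 0)
      (ex 0 (and (eqv (coord 0) 0 (coord 0) 1) (numEq N))))

/-- The formula that is valid if and only if some tuple `(N, k, 0)` belongs to the `e`-th graph,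
the formula `Γ` containing the axioms on tuples and graphs. -/
def reduction (Γ : Formula) (e N : ℕ) : Formula :=
  imp (and Γ (all 0 (imp (and (numEq N) (and (lit (coord 2) 0) (lit (graph e) 0))) fals))) fals

theorem inFragment_numEq (N : ℕ) : InFragment (numEq N) := by
  induction N with
  | zero => simp [numEq, inFragment_lit]
  | succ N ih => simp [numEq, InFragment, inFragment_eqv, ih]

theorem inFragment_reduction {Γ : Formula} {e N : ℕ} (h : InFragment Γ) :
    InFragment (reduction Γ e N) := by
  simp [reduction, InFragment, h, inFragment_numEq, inFragment_lit, inFragment_fals]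

theorem primrec_of_toNat {α : Type*} [Primcodable α] {f : α → Formula}
    (h : Primrec fun a => toNat (f a)) : Primrec f :=
  Primrec.encode_iff.1 h

theorem primrec_toNat : Primrec toNat := Primrec.encode

open Primrec in
theorem primrec_and (φ : Formula) : Primrec (and φ) :=
  primrec_of_toNat <| nat_add.comp (nat_add.comp (nat_mul.comp (const 6)
    (Primrec₂.natPair.comp (const _) primrec_toNat)) (const 1)) (const 1)

open Primrec in
theorem primrec_and_left (ψ : Formula) : Primrec fun φ => and φ ψ :=
  primrec_of_toNat <| nat_add.comp (nat_add.comp (nat_mul.comp (const 6)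
    (Primrec₂.natPair.comp primrec_toNat (const _))) (const 1)) (const 1)

open Primrec in
theorem primrec_imp_left (ψ : Formula) : Primrec fun φ => imp φ ψ :=
  primrec_of_toNat <| nat_add.comp (nat_add.comp (nat_mul.comp (const 6)
    (Primrec₂.natPair.comp primrec_toNat (const _))) (const 3)) (const 1)

open Primrec in
theorem primrec_all (x : ℕ) : Primrec (all x) :=
  primrec_of_toNat <| nat_add.comp (nat_add.comp (nat_mul.comp (const 6)
    (Primrec₂.natPair.comp (const _) primrec_toNat)) (const 4)) (const 1)

open Primrec in
theorem primrec_ex (x : ℕ) : Primrec (ex x) :=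
  primrec_of_toNat <| nat_add.comp (nat_add.comp (nat_mul.comp (const 6)
    (Primrec₂.natPair.comp (const _) primrec_toNat)) (const 5)) (const 1)

theorem primrec_numEq : Primrec numEq := by
  have step : Primrec fun φ => ex 1 (and (eqv (next 0) 1 (coord 0) 0)
      (ex 0 (and (eqv (coord 0) 0 (coord 0) 1) φ))) :=
    (primrec_ex 1).comp <| (primrec_and _).comp <| (primrec_ex 0).comp (primrec_and _)
  refine (Primrec.nat_rec₁ (lit (coord 0) 0) (step.comp Primrec.snd).to₂).of_eq fun N => ?_
  induction N with
  | zero => rfl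
  | succ N ih => simp only [numEq, ← ih]

theorem computable_reduction (Γ : Formula) (e : ℕ) : Computable (reduction Γ e) := by
  have h : Primrec (reduction Γ e) :=
    (primrec_imp_left _).comp <| (primrec_and _).comp <| (primrec_all 0).comp <|
      (primrec_imp_left _).comp <| (primrec_and_left _).comp primrec_numEq
  exact h.to_comp

end Formula

theorem forces_numEq {W : Type u} [PartialOrder W] {A : AugFrame.{u, v} W} {M : A.Interp} {w : W}
    {z : ℕ → A.Ind} {K : ℕ} (hz : Numerals M w z K) (hK : 0 < K) (N : ℕ) :
    ∀ g : ℕ → A.Ind, HasCoord M w z (g 0) 0 N → M.Forces w g (numEq N) := by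
  induction N with
  | zero => exact fun g hg => hg.at_zero hz
  | succ N ih =>
    intro g hg
    obtain ⟨d, hd, hda⟩ := hz.tuple fun _ => N
    refine ⟨d, hd, forces_eqv.2 ?_, d, hd, forces_eqv.2 ?_, ih _ ?_⟩
    · simpa using hz.next_eqv hd hK (hda 0 hK) hg
    · simpa using Eqv.refl d
    · simpa using hda 0 hK

theorem coord_eq_of_forces_numEq {W : Type u} [LinearOrder W] {s : ℕ → W} (hs : StrictMono s)
    {v : W} (h0 : s 0 ≤ v) (h1 : ¬ s 1 ≤ v) (N : ℕ) :
    ∀ g : ℕ → (tupleFrame.{u, v} W).Ind, (tupleModel s).Forces v g (numEq N) →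
      tup (g 0) 0 = N := by
  induction N with
  | zero =>
    intro g h
    rwa [numEq, forces_lit, at_tupleModel_iff_eq_zero hs h0 h1, letterVal_coord] at h
  | succ N ih =>
    rintro g ⟨d, -, hd, e, -, he, h⟩
    have := ih _ h
    rw [forces_eqv, eqv_tupleModel_iff hs h1, letterVal_coord] at hd he
    rw [letterVal_next] at hd
    rw [letterVal_coord] at he
    simp only [Function.update_self, Function.update_of_ne zero_ne_one,
      Function.update_of_ne one_ne_zero] at hd he this
    omega

theorem exists_primrec_of_rePred {p : ℕ → Prop} (hp : REPred p) :
    ∃ f : List.Vector ℕ 2 → ℕ, Nat.Primrec' f ∧ ∀ n, p n ↔ ∃ k, f (n ::ᵥ k ::ᵥ .nil) = 0 := by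
  obtain ⟨c, hc⟩ := Nat.Partrec.Code.exists_code.1 hp
  let F : ℕ → ℕ → ℕ := fun n k => bif (Nat.Partrec.Code.evaln k c n).isSome then 0 else 1
  have hF : Primrec₂ F := by
    have h : Primrec fun q : ℕ × ℕ => Nat.Partrec.Code.evaln q.2 c q.1 :=
      Nat.Partrec.Code.primrec_evaln.comp
        ((Primrec.snd.pair (Primrec.const c)).pair Primrec.fst)
    exact Primrec.cond (Primrec.option_isSome.comp h) (Primrec.const 0) (Primrec.const 1)
  refine ⟨fun v => F v.head v.tail.head, Nat.Primrec'.prim_iff₂.2 hF, fun n => ?_⟩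
  have h1 : p n ↔ (c.eval n).Dom := by rw [hc]; simp [Part.assert]
  rw [h1, Part.dom_iff_mem]
  simp only [Nat.Partrec.Code.evaln_complete]
  rw [exists_comm]
  refine exists_congr fun k => ?_
  cases h : Nat.Partrec.Code.evaln k c n <;> simp [F, h]

/-- If `f` has no zero of the form `(N, k)`, the formula fails in the countermodel at the world
`s 0`. -/
theorem not_valid_reduction {W : Type u} [LinearOrder W] {s : ℕ → W} (hs : StrictMono s)
    {Γ : Formula} {e N : ℕ} {f : List.Vector ℕ 2 → ℕ}
    (hΓ : ∀ g : ℕ → (tupleFrame.{u, v} W).Ind, (tupleModel s).Forces (s 0) g Γ)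
    (he : ∀ x, InGraph e x ↔ x 2 = f (firstCoords 2 x))
    (hf : ∀ k, f (N ::ᵥ k ::ᵥ .nil) ≠ 0) :
    ¬ (tupleFrame.{u, v} W).Valid (reduction Γ e N) := by
  intro h
  let g : ℕ → (tupleFrame.{u, v} W).Ind := fun _ => ofTup fun _ => 0
  have h01 : ¬ s 1 ≤ s 0 := not_le.2 (hs one_pos)
  refine h01 (forces_fals_tupleModel.1 (h (tupleModel s) (s 0) g (fun _ _ => Set.mem_univ _) (s 0)
    le_rfl ⟨hΓ g, ?_⟩))
  rintro u hu d - t ht ⟨hN, hzero, hgr⟩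
  rw [forces_fals_tupleModel]
  by_contra h1
  have h0 := hu.trans ht
  have hdN := coord_eq_of_forces_numEq hs h0 h1 N _ hN
  rw [forces_lit, at_tupleModel_iff_eq_zero hs h0 h1, letterVal_coord] at hzero
  rw [forces_lit, at_tupleModel_iff_eq_zero hs h0 h1, letterVal_graph_eq_zero, he] at hgr
  rw [Function.update_self] at hdN hzero hgr
  rw [hzero, firstCoords_succ, firstCoords_succ, hdN] at hgr
  exact hf _ hgr.symm

theorem valid_reduction {W : Type u} [LinearOrder W] {s : ℕ → W} {Γ : Formula} {K e N k : ℕ}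
    {f : List.Vector ℕ 2 → ℕ} (h : Axiomatizes.{u, v} s Γ K e 2 f)
    (hk : f (N ::ᵥ k ::ᵥ .nil) = 0) (A : AugFrame.{u, v} W) :
    A.Valid (reduction (and (tupleAx K) Γ) e N) := by
  rintro M _ g - w - ⟨⟨htuple, hΓ⟩, hgoal⟩
  by_contra hfals
  have hK := h.lt
  obtain ⟨z, hz⟩ := exists_numerals (by omega) htuple hfals
  let a : ℕ → ℕ := fun j => if j = 0 then N else if j = 1 then k else 0
  obtain ⟨d, hd, hda⟩ := hz.tuple a
  refine hfals (forces_fals_iff.1 (forces_of_all hgoal hd w le_rfl ⟨?_, ?_, ?_⟩))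
  · exact forces_numEq hz (by omega) N _
      (by rw [Function.update_self]; exact hda 0 (by omega))
  · rw [forces_lit, Function.update_self]
    exact (hda 2 hK).at_zero hz
  · rw [forces_lit, Function.update_self]
    exact h.complete A M w g z hz hΓ a hk.symm d hd fun j hj => hda j (by omega)

/-- One reduction serves both logics: it takes members of the set to formulas valid on all expanding
domains, and all other numbers to formulas refuted on a constant domain. -/
theorem exists_reduction {W : Type u} [LinearOrder W] {s : ℕ → W} (hs : StrictMono s)
    {p : ℕ → Prop} (hp : REPred p) :
    ∃ f : ℕ → Formula, Computable f ∧ (∀ n, (f n).InFragment) ∧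
      (∀ n, p n → f n ∈ QSILe.{u, v} W) ∧ ∀ n, f n ∈ QSILc.{u, v} W → p n := by
  obtain ⟨F, hF, hpF⟩ := exists_primrec_of_rePred hp
  obtain ⟨Γ, K, e, h⟩ := exists_axiomatizes.{u, v} hs hF
  refine ⟨reduction (and (tupleAx K) Γ) e, computable_reduction _ _,
    fun n => inFragment_reduction ⟨inFragment_tupleAx K, h.inFragment⟩, fun n hn A _ => ?_,
    fun n hn => ?_⟩
  · obtain ⟨k, hk⟩ := (hpF n).1 hn
    exact valid_reduction h hk A
  · by_contra hpn
    rw [hpF, not_exists] at hpn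
    exact not_valid_reduction hs (Γ := and (tupleAx K) Γ)
      (fun g => ⟨forces_tupleAx_tupleModel hs le_rfl K, h.sound _ g le_rfl⟩) h.inGraph_iff hpn
      (hn (tupleFrame W) fun _ _ _ => rfl)

theorem sigmaOneHardIn_of_strictMono {W : Type u} [LinearOrder W] {s : ℕ → W}
    (hs : StrictMono s) :
    SigmaOneHardIn InFragment (QSILe.{u, v} W) ∧ SigmaOneHardIn InFragment (QSILc.{u, v} W) := by
  have hsub : QSILe.{u, v} W ⊆ QSILc.{u, v} W := fun φ h A _ => h A (Set.mem_univ A)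
  constructor <;> intro p hp <;>
    obtain ⟨f, hf, hfrag, hval, hinv⟩ := exists_reduction.{u, v} hs hp
  · exact ⟨f, hf, hfrag, fun n => ⟨hval n, fun h => hinv n (hsub h)⟩⟩
  · exact ⟨f, hf, hfrag, fun n => ⟨fun h => hsub (hval n h), hinv n⟩⟩

end SuperInt

theorem mainTheorem8 :
    (SuperInt.SigmaOneHardIn SuperInt.Formula.InFragment (SuperInt.QSILe.{0, v} ℤ) ∧
      SuperInt.SigmaOneHardIn SuperInt.Formula.InFragment (SuperInt.QSILc.{0, v} ℤ)) ∧
    (SuperInt.SigmaOneHardIn SuperInt.Formula.InFragment (SuperInt.QSILe.{0, v} ℝ) ∧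
      SuperInt.SigmaOneHardIn SuperInt.Formula.InFragment (SuperInt.QSILc.{0, v} ℝ)) ∧
    ∀ α : Ordinal.{u}, Ordinal.omega0 ≤ α →
      SuperInt.SigmaOneHardIn SuperInt.Formula.InFragment (SuperInt.QSILe.{u + 1, v} (Set.Iio α)) ∧
      SuperInt.SigmaOneHardIn SuperInt.Formula.InFragment
        (SuperInt.QSILc.{u + 1, v} (Set.Iio α)) := by
  refine ⟨SuperInt.sigmaOneHardIn_of_strictMono (s := fun n : ℕ => (n : ℤ)) Nat.strictMono_cast,
    SuperInt.sigmaOneHardIn_of_strictMono (s := fun n : ℕ => (n : ℝ)) Nat.strictMono_cast,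
    fun α hα => ?_⟩
  exact SuperInt.sigmaOneHardIn_of_strictMono
    (s := fun n : ℕ => (⟨n, (Ordinal.natCast_lt_omega0 n).trans_le hα⟩ : Set.Iio α))
    fun m n h => Subtype.mk_lt_mk.2 (Nat.cast_lt.2 h)
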